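/- For each integer $n\ge 0$ let $SG(n)$ be the two-dimensional Sierpinski gasket graph at stage $n$: $SG(0)$ is a triangle, with leftmost vertex $o$, rightmost vertex $a_0$ and topmost vertex $b_0$; and $SG(n+1)$ is obtained by juxtaposing three copies of $SG(n)$ in the plane, namely $SG(n)$ itself, its translate whose leftmost vertex is $a_n$, and its translate whose leftmost vertex is $b_n$ (so that any two of the copies share exactly one corner vertex). Here $o$, $a_n$, $b_n$ denote the leftmost, rightmost and topmost corner of $SG(n)$. A spanning subgraph of $SG(n)$ is a subgraph with the same vertex set. Let $f(n)$ be the number of spanning trees of $SG(n)$, and for a vertex $x$ let $f_j(n,x)$ be the number of spanning trees in which $x$ has degree exactly $j$. Let $g(n)$ be the number of spanning subgraphs of $SG(n)$ that consist of exactly two trees (a tree may be a single isolated vertex), one of them containing $b_n$ and the other containing both $o$ and $a_n$, and let $g_i(n,x)$ be the number of those in which $x$ has degree exactly $i$. Put $F_j(n,x)=f_j(n,x)/f(n)$ and $G_i(n,x)=g_i(n,x)/g(n)$. Then for every integer $n\ge 0$, \[ F_1(n,o)=\frac{11}{14}-\frac{5}{42}\Bigl(\frac1{15}\Bigr)^n,\qquad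 F_2(n,o)=\frac{3}{14}+\frac{5}{42}\Bigl(\frac1{15}\Bigr)^n, \] \[ G_1(n,o)=\frac{11}{14}+\frac{3}{14}\Bigl(\frac1{15}\Bigr)^n,\qquad G_2(n,o)=\frac{3}{14}-\frac{3}{14}\Bigl(\frac1{15}\Bigr)^n. \] -/

import Mathlib

/-! The Sierpinski gasket graphs are realized in the lattice coordinates `(i, j)`, standing for the
point `i • u + j • v` of the plane, where `u` and `v` are the unit vectors at angles `0` and `60`
degrees.  Thus `SG(n)` is a triangle of side length `2 ^ n` whose leftmost vertex `o` is the
origin. -/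

namespace SierpinskiGasket

/-- The vertices of `SG(n)`: three copies of the previous stage, of side length `2 ^ n`, are
juxtaposed to form stage `n + 1`. -/
def verts : ℕ → Finset (ℕ × ℕ)
  | 0 => {(0, 0), (1, 0), (0, 1)}
  | n + 1 => verts n ∪ (verts n).image (fun p => (p.1 + 2 ^ n, p.2)) ∪
      (verts n).image (fun p => (p.1, p.2 + 2 ^ n))

/-- The edges of `SG(n)`, as a graph on the whole lattice: stage `0` is a triangle, and stage
`n + 1` consists of the edges of three copies of stage `n`. -/
def latticeGraph : ℕ → SimpleGraph (ℕ × ℕ)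
  | 0 => SimpleGraph.fromRel (fun p q => p ∈ verts 0 ∧ q ∈ verts 0)
  | n + 1 => latticeGraph n ⊔ (latticeGraph n).map (fun p => (p.1 + 2 ^ n, p.2)) ⊔
      (latticeGraph n).map (fun p => (p.1, p.2 + 2 ^ n))

/-- The vertex type of `SG(n)`. -/
abbrev Vert (n : ℕ) : Type := {p : ℕ × ℕ // p ∈ verts n}

/-- The two-dimensional Sierpinski gasket graph `SG(n)`. -/
def SG (n : ℕ) : SimpleGraph (Vert n) :=
  (latticeGraph n).comap Subtype.val

theorem corner_mem (n : ℕ) :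
    (0, 0) ∈ verts n ∧ (2 ^ n, 0) ∈ verts n ∧ (0, 2 ^ n) ∈ verts n := by
  induction n with
  | zero => simp [verts]
  | succ n ih =>
    obtain ⟨h0, h1, h2⟩ := ih
    refine ⟨?_, ?_, ?_⟩ <;> simp only [verts, Finset.mem_union, Finset.mem_image]
    · exact Or.inl (Or.inl h0)
    · exact Or.inl (Or.inr ⟨_, h1, by simp [pow_succ, mul_two]⟩)
    · exact Or.inr ⟨_, h2, by simp [pow_succ, mul_two]⟩

/-- The leftmost vertex `o` of `SG(n)`. -/
def o (n : ℕ) : Vert n := ⟨(0, 0), (corner_mem n).1⟩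

/-- The rightmost vertex `a_n` of `SG(n)`. -/
def a (n : ℕ) : Vert n := ⟨(2 ^ n, 0), (corner_mem n).2.1⟩

/-- The topmost vertex `b_n` of `SG(n)`. -/
def b (n : ℕ) : Vert n := ⟨(0, 2 ^ n), (corner_mem n).2.2⟩

/-- The spanning trees of `SG(n)`.  A spanning subgraph is a graph `T ≤ SG n` on the same
vertices. -/
def spanningTrees (n : ℕ) : Set (SimpleGraph (Vert n)) :=
  {T | T ≤ SG n ∧ T.IsTree}

/-- The spanning subgraphs of `SG(n)` that consist of two trees (one of which may be an isolated
vertex), one containing `b_n` and the other containing both `o` and `a_n`. -/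
def twoTrees (n : ℕ) : Set (SimpleGraph (Vert n)) :=
  {T | T ≤ SG n ∧ T.IsAcyclic ∧ Nat.card T.ConnectedComponent = 2 ∧
    T.Reachable (o n) (a n) ∧ ¬ T.Reachable (o n) (b n)}

/-- The number of bonds of `T` at the vertex `x`. -/
noncomputable def bonds {n : ℕ} (T : SimpleGraph (Vert n)) (x : Vert n) : ℕ :=
  (T.neighborSet x).ncard

/-- `f(n)`: the number of spanning trees of `SG(n)`. -/
noncomputable def numF (n : ℕ) : ℕ := (spanningTrees n).ncard

/-- `f_j(n, x)`: the number of spanning trees of `SG(n)` with exactly `j` bonds at `x`. -/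
noncomputable def numFAt (j n : ℕ) (x : Vert n) : ℕ :=
  {T ∈ spanningTrees n | bonds T x = j}.ncard

/-- `g(n)`: the number of two-tree spanning subgraphs separating `b_n` from `o` and `a_n`. -/
noncomputable def numG (n : ℕ) : ℕ := (twoTrees n).ncard

/-- `g_i(n, x)`: the number of those with exactly `i` bonds at `x`. -/
noncomputable def numGAt (i n : ℕ) (x : Vert n) : ℕ :=
  {T ∈ twoTrees n | bonds T x = i}.ncard

/-- The probability `F_j(n, x) = f_j(n, x) / f(n)`. -/
noncomputable def F (j n : ℕ) (x : Vert n) : ℝ := (numFAt j n x : ℝ) / (numF n : ℝ)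

/-- The probability `G_i(n, x) = g_i(n, x) / g(n)`. -/
noncomputable def G (i n : ℕ) (x : Vert n) : ℝ := (numGAt i n x : ℝ) / (numG n : ℝ)

end SierpinskiGasket

/-! A spanning forest of `SG(n + 1)` in which every tree contains an outer corner restricts to
forests of the three copies of `SG(n)` with the analogous property, because a path leaves a copy
only through a corner. How the outer corners are connected depends only on the patterns of the three
restrictions, and an edge count decides whether gluing closes a cycle
(`IsGluing.isForest_glue_iff`). Hence the numbers of forests by pattern satisfy explicit cubic
recursions (`count_succ`). Since `o` lies in the copy `0` only, the numbers with prescribed degree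
at `o` satisfy recursions linear in those of that copy (`countAt_succ`).

The number of forests depends only on the number of trees: say `f`, `g`, `h` for one, two, three
trees. The relation `f * h = 3 * g ^ 2` persists through all stages (`exists_hasCounts`), which
turns the recursions into `f' = 6 f² g` and `g' = 10 f g²`. The proportions then obey a linear
system with constant coefficients, `F' = (2 F + G) / 3` and `G' = (3 F + 2 G) / 5`. Its matrix has
the eigenvalue `1` with eigenvector `(1, 1)` and the eigenvalue `1 / 15` with eigenvector `(5, -9)`.
The solution is therefore `F = A + 5 B / 15 ^ n`, `G = A - 9 B / 15 ^ n` (`countAt_eq`), with `A`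
and `B` read off from the triangle. -/

namespace SierpinskiGasket

/-! ### Connectivity patterns of three corners -/

/-- The partitions of the three corners of a gasket into connectivity classes: all corners
together, the corner `k` separated from the other two, or all corners separated. -/
inductive Pattern
  | full
  | sep (k : Fin 3)
  | discrete
  deriving DecidableEq, Fintype

namespace Pattern

/-- Whether the corners `k` and `l` are in the same class. -/
def rel : Pattern → Fin 3 → Fin 3 → Bool
  | full, _, _ => true
  | sep m, k, l => k == l || (k != m && l != m)
  | discrete, k, l => k == l

/-- The number of classes. -/
def size : Pattern → ℕ
  | full => 1
  | sep _ => 2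
  | discrete => 3

/-- Whether the corner `k` belongs to a class with at least two members (there is at most one such
class). -/
def inBlock : Pattern → Fin 3 → Bool
  | full, _ => true
  | sep m, k => k != m
  | discrete, _ => false

/-- Three elements leave room for at most one class with several members, so a single set, the
`mask`, records all connections inside a copy. -/
theorem rel_iff : ∀ (p : Pattern) (k l : Fin 3),
    p.rel k l = true ↔ k = l ∨ (p.inBlock k = true ∧ p.inBlock l = true) := by
  decide

theorem ext_rel : ∀ {p q : Pattern}, (∀ k l, p.rel k l = q.rel k l) → p = q := by
  decide

/-- Every equivalence relation on the three corners is given by a pattern. -/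
theorem exists_rel_iff (r : Setoid (Fin 3)) : ∃ p : Pattern, ∀ k l, r k l ↔ p.rel k l = true := by
  have hs (k l) : r k l ↔ r l k := ⟨fun h => r.symm h, fun h => r.symm h⟩
  have ht {k l m} (h : r k l) (h' : r l m) : r k m := r.trans h h'
  have h10 := hs 1 0
  have h20 := hs 2 0
  have h21 := hs 2 1
  by_cases h01 : r 0 1 <;> by_cases h02 : r 0 2 <;> by_cases h12 : r 1 2
  · exact ⟨full, by simp [Fin.forall_fin_succ, rel, h10, h20, h21, h01, h02, h12]⟩
  · exact absurd (ht (h10.2 h01) h02) h12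
  · exact absurd (ht h01 h12) h02
  · exact ⟨sep 2, by simp [Fin.forall_fin_succ, rel, h10, h20, h21, h01, h02, h12]⟩
  · exact absurd (ht h02 (h21.2 h12)) h01
  · exact ⟨sep 1, by simp [Fin.forall_fin_succ, rel, h10, h20, h21, h01, h02, h12]⟩
  · exact ⟨sep 0, by simp [Fin.forall_fin_succ, rel, h10, h20, h21, h01, h02, h12]⟩
  · exact ⟨discrete, by simp [Fin.forall_fin_succ, rel, h10, h20, h21, h01, h02, h12]⟩

end Pattern

/-! ### Combining the patterns of three copies -/

/-! When three copies of a gasket are juxtaposed, the corner `l` of copy `k` is identified with the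
corner `k` of copy `l`, so that the corners of the copies are six points.  Sets of these points are
encoded as binary numbers. -/

/-- The number, between `0` and `5`, of the corner `l` of the copy `k`. -/
def point (k l : Fin 3) : ℕ := if k = l then k else 6 - (k + l)

theorem point_lt : ∀ k l, point k l < 6 := by decide

theorem point_self : ∀ k, point k k = k := by decide

theorem point_comm : ∀ k l, point k l = point l k := by decide

theorem point_eq_iff : ∀ k l k' l', point k l = point k' l' ↔
    (k = k' ∧ l = l') ∨ (k = l' ∧ l = k') := by decide

/-- The points of the copy `k` in the nontrivial class of `p`. -/
def mask (p : Pattern) (k : Fin 3) : ℕ :=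
  (if p.inBlock 0 then 2 ^ point k 0 else 0) ||| (if p.inBlock 1 then 2 ^ point k 1 else 0) |||
    (if p.inBlock 2 then 2 ^ point k 2 else 0)

theorem testBit_mask_iff (p : Pattern) (k : Fin 3) (y : ℕ) :
    (mask p k).testBit y = true ↔ ∃ l, p.inBlock l = true ∧ point k l = y := by
  have h : ∀ (b : Bool) (m : ℕ), (if b = true then 2 ^ m else 0).testBit y = true ↔
      b = true ∧ m = y := by
    intro b m
    cases b <;> simp [Nat.testBit_two_pow]
  simp [mask, h, Fin.exists_fin_succ, or_assoc]

/-- Add the set `M` to the set `S` if the two meet. -/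
def absorb (M S : ℕ) : ℕ := if S &&& M = 0 then S else S ||| M

theorem testBit_absorb_of_testBit {M S y : ℕ} (h : S.testBit y = true) :
    (absorb M S).testBit y = true := by
  unfold absorb
  split_ifs <;> simp [h]

theorem testBit_absorb_of_meet {M S y z : ℕ} (hS : S.testBit z = true) (hM : M.testBit z = true)
    (hy : M.testBit y = true) : (absorb M S).testBit y = true := by
  have : S &&& M ≠ 0 := fun h => by simpa [hS, hM] using congrArg (Nat.testBit · z) h
  simp [absorb, this, hy]

theorem absorb_induction {M S : ℕ} {R : ℕ → Prop} (hS : ∀ y, S.testBit y = true → R y)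
    (hM : ∀ y z, M.testBit z = true → M.testBit y = true → R z → R y) :
    ∀ y, (absorb M S).testBit y = true → R y := by
  intro y hy
  unfold absorb at hy
  split_ifs at hy with h
  · exact hS y hy
  · rw [Nat.testBit_or, Bool.or_eq_true] at hy
    obtain ⟨z, hz⟩ := Nat.exists_testBit_of_ne_zero h
    rw [Nat.testBit_and, Bool.and_eq_true] at hz
    exact hy.elim (hS y) fun hy => hM y z hz.2 hy (hS z hz.1)

/-- Absorb the nontrivial classes of the three copies. -/
def absorbAll (p₀ p₁ p₂ : Pattern) (S : ℕ) : ℕ :=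
  absorb (mask p₂ 2) (absorb (mask p₁ 1) (absorb (mask p₀ 0) S))

/-- The set of the points connected to the point `x` when the copies have the patterns `p₀`, `p₁`
and `p₂`. -/
def cluster (p₀ p₁ p₂ : Pattern) (x : ℕ) : ℕ :=
  absorbAll p₀ p₁ p₂ (absorbAll p₀ p₁ p₂ (absorbAll p₀ p₁ p₂ (2 ^ x)))

/-- Three rounds suffice: a round that changes the set absorbs at least one new mask, and there are
only three masks. -/
theorem absorb_cluster : ∀ (p₀ p₁ p₂ : Pattern) (x : Fin 6),
    absorb (mask p₀ 0) (cluster p₀ p₁ p₂ x) = cluster p₀ p₁ p₂ x ∧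
    absorb (mask p₁ 1) (cluster p₀ p₁ p₂ x) = cluster p₀ p₁ p₂ x ∧
    absorb (mask p₂ 2) (cluster p₀ p₁ p₂ x) = cluster p₀ p₁ p₂ x := by
  decide +kernel

theorem testBit_cluster_self (p₀ p₁ p₂ : Pattern) (x : ℕ) :
    (cluster p₀ p₁ p₂ x).testBit x = true := by
  unfold cluster absorbAll
  repeat apply testBit_absorb_of_testBit
  exact Nat.testBit_two_pow_self

theorem testBit_cluster_of_rel (p : Fin 3 → Pattern) {x : ℕ} (hx : x < 6) {k l l' : Fin 3}
    (h : (cluster (p 0) (p 1) (p 2) x).testBit (point k l) = true) (hl : (p k).rel l l' = true) :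
    (cluster (p 0) (p 1) (p 2) x).testBit (point k l') = true := by
  obtain rfl | ⟨hl, hl'⟩ := (Pattern.rel_iff _ _ _).1 hl
  · exact h
  · have key : absorb (mask (p k) k) (cluster (p 0) (p 1) (p 2) x) =
        cluster (p 0) (p 1) (p 2) x := by
      obtain ⟨h0, h1, h2⟩ := absorb_cluster (p 0) (p 1) (p 2) ⟨x, hx⟩
      fin_cases k
      exacts [h0, h1, h2]
    rw [← key]
    exact testBit_absorb_of_meet h ((testBit_mask_iff _ _ _).2 ⟨l, hl, rfl⟩)
      ((testBit_mask_iff _ _ _).2 ⟨l', hl', rfl⟩)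

/-- Together with `testBit_cluster_self` and `testBit_cluster_of_rel`, this characterizes the
cluster as the least set that contains `x` and is closed under the connections within copies. -/
theorem cluster_induction (p : Fin 3 → Pattern) {x : ℕ} {R : ℕ → Prop} (hx : R x)
    (hR : ∀ k l l', (p k).rel l l' = true → R (point k l) → R (point k l')) :
    ∀ y, (cluster (p 0) (p 1) (p 2) x).testBit y = true → R y := by
  have hM (k : Fin 3) (y z : ℕ) (hz : (mask (p k) k).testBit z = true)
      (hy : (mask (p k) k).testBit y = true) (h : R z) : R y := by
    obtain ⟨l, hl, rfl⟩ := (testBit_mask_iff _ _ _).1 hz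
    obtain ⟨l', hl', rfl⟩ := (testBit_mask_iff _ _ _).1 hy
    exact hR k l l' ((Pattern.rel_iff _ _ _).2 (Or.inr ⟨hl, hl'⟩)) h
  have hA (S : ℕ) (hS : ∀ y, S.testBit y = true → R y) :
      ∀ y, (absorbAll (p 0) (p 1) (p 2) S).testBit y = true → R y :=
    absorb_induction (absorb_induction (absorb_induction hS (hM 0)) (hM 1)) (hM 2)
  refine hA _ (hA _ (hA _ fun y hy => ?_))
  rw [Nat.testBit_two_pow, decide_eq_true_eq] at hy
  exact hy ▸ hx

/-- Copies with the patterns `p₀`, `p₁` and `p₂` produce the pattern `q` on the outer corners, and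
every point is connected to an outer corner. -/
def Joins (p₀ p₁ p₂ q : Pattern) : Prop :=
  (∀ y : Fin 6, ∃ k : Fin 3, (cluster p₀ p₁ p₂ k).testBit y = true) ∧
    ∀ k l : Fin 3, (cluster p₀ p₁ p₂ k).testBit l = q.rel k l

instance (p₀ p₁ p₂ q : Pattern) : Decidable (Joins p₀ p₁ p₂ q) := by
  unfold Joins
  infer_instance

/-- Consider the bipartite incidence graph between the six points and the classes of the copies. It
has nine edges and, as every point is connected to an outer corner, `q.size` components. The bound
is vertices ≤ edges + components, with equality exactly when there is no cycle. -/
theorem Joins.size_le : ∀ {p₀ p₁ p₂ q : Pattern}, Joins p₀ p₁ p₂ q →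
    p₀.size + p₁.size + p₂.size ≤ 3 + q.size := by
  decide +kernel

/-- Copies with the patterns `p₀`, `p₁` and `p₂` produce the pattern `q` without closing a
cycle. -/
def Glues (p₀ p₁ p₂ q : Pattern) : Prop :=
  p₀.size + p₁.size + p₂.size = 3 + q.size ∧ Joins p₀ p₁ p₂ q

instance (p₀ p₁ p₂ q : Pattern) : Decidable (Glues p₀ p₁ p₂ q) := by
  unfold Glues
  infer_instance

/-- The triples of patterns that produce `q` without closing a cycle. -/
def gluings (q : Pattern) : Finset (Pattern × Pattern × Pattern) :=
  {x | Glues x.1 x.2.1 x.2.2 q}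

/-! ### Spanning forests and edge counts -/

variable {V W : Type*}

/-- `T` is a spanning forest of which every tree contains one of the three corners `c`, and which
connects the corners according to the pattern `p`.  Acyclicity is expressed by the number of
edges. -/
structure IsForest (T : SimpleGraph V) (c : Fin 3 → V) (p : Pattern) : Prop where
  cover : ∀ v, ∃ k, T.Reachable (c k) v
  rel : ∀ k l, T.Reachable (c k) (c l) ↔ p.rel k l = true
  card : T.edgeSet.ncard + p.size = Nat.card V

theorem exists_pattern (T : SimpleGraph V) (c : Fin 3 → V) :
    ∃ p : Pattern, ∀ k l, T.Reachable (c k) (c l) ↔ p.rel k l = true :=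
  Pattern.exists_rel_iff (T.reachableSetoid.comap c)

theorem pattern_unique {T : SimpleGraph V} {c : Fin 3 → V} {p q : Pattern}
    (hp : ∀ k l, T.Reachable (c k) (c l) ↔ p.rel k l = true)
    (hq : ∀ k l, T.Reachable (c k) (c l) ↔ q.rel k l = true) : p = q :=
  Pattern.ext_rel fun k l => Bool.eq_iff_iff.2 ((hp k l).symm.trans (hq k l))

theorem card_le_of_forall_reachable [Finite V] {T : SimpleGraph V} {x : V}
    (h : ∀ v, T.Reachable x v) : Nat.card V ≤ T.edgeSet.ncard + 1 := by
  have hT : T.Connected := T.connected_iff_exists_forall_reachable.2 ⟨x, h⟩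
  simpa using hT.card_vert_le_card_edgeSet_add_one

theorem reachable_sup_edge (T : SimpleGraph V) (x y : V) :
    (T ⊔ SimpleGraph.edge x y).Reachable x y := by
  by_cases hxy : x = y
  · exact hxy ▸ .refl _
  · exact SimpleGraph.Adj.reachable (Or.inr (by simp [SimpleGraph.edge_adj, hxy]))

theorem ncard_edgeSet_sup_edge_le [Finite V] (T : SimpleGraph V) (x y : V) :
    (T ⊔ SimpleGraph.edge x y).edgeSet.ncard ≤ T.edgeSet.ncard + 1 := by
  have h : (T ⊔ SimpleGraph.edge x y).edgeSet ⊆ insert s(x, y) T.edgeSet := by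
    intro e he
    rw [SimpleGraph.edgeSet_sup] at he
    refine he.elim (fun h => Or.inr h) fun h => Or.inl ?_
    simpa using SimpleGraph.edgeSet_fromEdgeSet _ ▸ h |>.1
  exact (Set.ncard_le_ncard h (Set.toFinite _)).trans (Set.ncard_insert_le _ _)

theorem forall_reachable_sup_edge {T : SimpleGraph V} {x y : V}
    (h : ∀ v, T.Reachable x v ∨ T.Reachable y v) (v : V) :
    (T ⊔ SimpleGraph.edge x y).Reachable x v :=
  (h v).elim (fun h => h.mono le_sup_left)
    fun h => (reachable_sup_edge T x y).trans (h.mono le_sup_left)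

theorem card_le_of_forall_reachable_or [Finite V] {T : SimpleGraph V} {x y : V}
    (h : ∀ v, T.Reachable x v ∨ T.Reachable y v) : Nat.card V ≤ T.edgeSet.ncard + 2 := by
  have h1 := card_le_of_forall_reachable (forall_reachable_sup_edge h)
  have h2 := ncard_edgeSet_sup_edge_le T x y
  omega

/-- Adding `p.size - 1` edges between corners makes the graph connected. Equality here is the
acyclicity condition of `IsForest`. -/
theorem card_le_ncard_edgeSet_add_size [Finite V] {T : SimpleGraph V} {c : Fin 3 → V} {p : Pattern}
    (hT : ∀ v, ∃ k, T.Reachable (c k) v)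
    (hp : ∀ k l, T.Reachable (c k) (c l) ↔ p.rel k l = true) :
    Nat.card V ≤ T.edgeSet.ncard + p.size := by
  cases p with
  | full =>
    refine card_le_of_forall_reachable (x := c 0) fun v => ?_
    obtain ⟨k, hk⟩ := hT v
    exact ((hp 0 k).2 rfl).trans hk
  | sep m =>
    refine card_le_of_forall_reachable_or (x := c m) (y := c (m + 1)) fun v => ?_
    obtain ⟨k, hk⟩ := hT v
    by_cases hkm : k = m
    · exact Or.inl (hkm ▸ hk)
    · refine Or.inr (((hp (m + 1) k).2 ?_).trans hk)
      clear hp hk hT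
      revert m k
      decide
  | discrete =>
    have h1 := ncard_edgeSet_sup_edge_le T (c 0) (c 1)
    have h2 : Nat.card V ≤ (T ⊔ SimpleGraph.edge (c 0) (c 1)).edgeSet.ncard + 2 := by
      refine card_le_of_forall_reachable_or (x := c 0) (y := c 2) fun v => ?_
      obtain ⟨k, hk⟩ := hT v
      replace hk := hk.mono (le_sup_left : T ≤ T ⊔ SimpleGraph.edge (c 0) (c 1))
      fin_cases k
      · exact Or.inl hk
      · exact Or.inl ((reachable_sup_edge T _ _).trans hk)
      · exact Or.inr hk
    simp only [Pattern.size]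
    omega

theorem isTree_iff_isForest [Finite V] {T : SimpleGraph V} {c : Fin 3 → V} :
    T.IsTree ↔ IsForest T c .full := by
  rw [SimpleGraph.isTree_iff_connected_and_card]
  constructor
  · rintro ⟨h1, h2⟩
    exact ⟨fun v => ⟨0, h1 _ _⟩, fun k l => by simp [h1 (c k) (c l), Pattern.rel], by
      simpa [Pattern.size] using h2⟩
  · rintro ⟨h1, h2, h3⟩
    refine ⟨T.connected_iff_exists_forall_reachable.2 ⟨c 0, fun v => ?_⟩, by
      simpa [Pattern.size] using h3⟩
    obtain ⟨k, hk⟩ := h1 v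
    exact ((h2 0 k).2 rfl).trans hk

/-- The edge `x y` joins the two components without creating a cycle, so the edge count criterion
for trees applies to the enlarged graph. -/
theorem isAcyclic_iff_of_two_components [Finite V] {T : SimpleGraph V} {x y : V}
    (hxy : ¬ T.Reachable x y) (h : ∀ v, T.Reachable x v ∨ T.Reachable y v) :
    T.IsAcyclic ↔ T.edgeSet.ncard + 2 = Nat.card V := by
  have hc : (T ⊔ SimpleGraph.edge x y).Connected :=
    SimpleGraph.connected_iff_exists_forall_reachable _ |>.2 ⟨x, forall_reachable_sup_edge h⟩
  have hne : x ≠ y := fun h => hxy (h ▸ .refl _)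
  have hcard : (T ⊔ SimpleGraph.edge x y).edgeSet.ncard = T.edgeSet.ncard + 1 := by
    have : (T ⊔ SimpleGraph.edge x y).edgeSet = insert s(x, y) T.edgeSet := by
      rw [SimpleGraph.edgeSet_sup, SimpleGraph.edgeSet_edge_of_ne hne, Set.union_singleton]
    have hxyT : s(x, y) ∉ T.edgeSet := fun h => hxy (SimpleGraph.Adj.reachable h)
    rw [this, Set.ncard_insert_of_notMem hxyT]
  have h1 : (T ⊔ SimpleGraph.edge x y).IsAcyclic ↔ T.IsAcyclic :=
    SimpleGraph.isAcyclic_add_edge_iff_of_not_reachable x y hxy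
  have h2 := SimpleGraph.isTree_iff_connected_and_card (G := T ⊔ SimpleGraph.edge x y)
  rw [SimpleGraph.isTree_iff, h1] at h2
  simp only [hc, true_and, Nat.card_coe_set_eq, hcard] at h2
  exact h2

theorem card_connectedComponent_eq_two_iff {T : SimpleGraph V} {x y : V} (hxy : ¬ T.Reachable x y) :
    Nat.card T.ConnectedComponent = 2 ↔ ∀ v, T.Reachable x v ∨ T.Reachable y v := by
  have hne : T.connectedComponentMk x ≠ T.connectedComponentMk y :=
    fun h => hxy (SimpleGraph.ConnectedComponent.exact h)
  have key : (∀ v, T.Reachable x v ∨ T.Reachable y v) ↔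
      ({T.connectedComponentMk x, T.connectedComponentMk y} : Set T.ConnectedComponent) =
        Set.univ := by
    rw [Set.eq_univ_iff_forall]
    constructor
    · intro h C
      induction C using SimpleGraph.ConnectedComponent.ind with | _ v
      exact (h v).imp (fun h => SimpleGraph.ConnectedComponent.sound h.symm)
        fun h => SimpleGraph.ConnectedComponent.sound h.symm
    · exact fun h v => (h (T.connectedComponentMk v)).imp
        (fun h => (SimpleGraph.ConnectedComponent.exact h).symm)
        fun h => (SimpleGraph.ConnectedComponent.exact h).symm
  rw [key]
  constructor
  · intro h
    have : Finite T.ConnectedComponent := Nat.finite_of_card_ne_zero (by omega)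
    exact Set.eq_of_subset_of_ncard_le (Set.subset_univ _)
      (by rw [Set.ncard_univ, h, Set.ncard_pair hne]) (Set.toFinite _)
  · intro h
    rw [← Set.ncard_univ, ← h, Set.ncard_pair hne]

theorem twoTrees_iff_isForest [Finite V] {T : SimpleGraph V} {c : Fin 3 → V} :
    (T.IsAcyclic ∧ Nat.card T.ConnectedComponent = 2 ∧ T.Reachable (c 0) (c 1) ∧
      ¬ T.Reachable (c 0) (c 2)) ↔ IsForest T c (.sep 2) := by
  constructor
  · rintro ⟨h1, h2, h3, h4⟩
    rw [card_connectedComponent_eq_two_iff h4] at h2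
    refine ⟨fun v => (h2 v).elim (fun h => ⟨0, h⟩) fun h => ⟨2, h⟩, ?_,
      (isAcyclic_iff_of_two_components h4 h2).1 h1⟩
    have h5 : ¬ T.Reachable (c 1) (c 2) := fun h => h4 (h3.trans h)
    simp [Fin.forall_fin_succ, Pattern.rel, h3, h3.symm, h4, h5, T.reachable_comm (u := c 2)]
  · rintro ⟨h1, h2, h3⟩
    have h4 : ¬ T.Reachable (c 0) (c 2) := by rw [h2]; decide
    have h5 : ∀ v, T.Reachable (c 0) v ∨ T.Reachable (c 2) v := by
      intro v
      obtain ⟨k, hk⟩ := h1 v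
      fin_cases k
      · exact Or.inl hk
      · exact Or.inl (((h2 0 1).2 rfl).trans hk)
      · exact Or.inr hk
    exact ⟨(isAcyclic_iff_of_two_components h4 h5).2 h3,
      (card_connectedComponent_eq_two_iff h4).2 h5, (h2 0 1).2 rfl, h4⟩

/-! ### Gluing three copies of a graph -/

/-- `W` consists of three copies of `V`, embedded by `i`, where the corner `l` of the copy `k` is
identified with the corner `k` of the copy `l` and there are no other identifications. -/
structure IsGluing (c : Fin 3 → V) (i : Fin 3 → V → W) : Prop where
  corner_injective : Function.Injective c
  injective : ∀ k, Function.Injective (i k)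
  comm : ∀ k l, i k (c l) = i l (c k)
  overlap : ∀ {k l u v}, k ≠ l → i k u = i l v → u = c l ∧ v = c k
  cover : ∀ w, ∃ k u, i k u = w

/-- The union of graphs on the three copies. -/
def glue (i : Fin 3 → V → W) (t : Fin 3 → SimpleGraph V) : SimpleGraph W :=
  ⨆ k, (t k).map (i k)

/-- The three outer corners. -/
def outer (c : Fin 3 → V) (i : Fin 3 → V → W) (k : Fin 3) : W := i k (c k)

namespace IsGluing

variable {c : Fin 3 → V} {i : Fin 3 → V → W} {t : Fin 3 → SimpleGraph V}

theorem glue_adj (h : IsGluing c i) {x y : W} :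
    (glue i t).Adj x y ↔ ∃ k u v, (t k).Adj u v ∧ i k u = x ∧ i k v = y := by
  simp only [glue, SimpleGraph.iSup_adj, SimpleGraph.map_adj']
  constructor
  · rintro ⟨k, -, u, v, huv⟩
    exact ⟨k, u, v, huv⟩
  · rintro ⟨k, u, v, huv, rfl, rfl⟩
    exact ⟨k, (h.injective k).ne huv.ne, u, v, huv, rfl, rfl⟩

/-- Distinct copies share only one vertex, so an edge determines its copy. -/
theorem eq_of_eq_of_eq (h : IsGluing c i) {k l : Fin 3} {u v u' v' : V} (huv : u ≠ v)
    (hu : i k u = i l u') (hv : i k v = i l v') : k = l := by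
  by_contra hkl
  exact huv ((h.overlap hkl hu).1.trans (h.overlap hkl hv).1.symm)

theorem glue_adj_apply (h : IsGluing c i) {k : Fin 3} {u v : V} :
    (glue i t).Adj (i k u) (i k v) ↔ (t k).Adj u v := by
  rw [h.glue_adj]
  constructor
  · rintro ⟨l, u', v', huv, hu, hv⟩
    obtain rfl := h.eq_of_eq_of_eq huv.ne hu hv
    rwa [← h.injective _ hu, ← h.injective _ hv]
  · exact fun huv => ⟨k, u, v, huv, rfl, rfl⟩

theorem comap_glue (h : IsGluing c i) (k : Fin 3) : (glue i t).comap (i k) = t k := by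
  ext u v
  exact h.glue_adj_apply

theorem glue_injective (h : IsGluing c i) : Function.Injective (glue i) := by
  intro t t' htt
  funext k
  rw [← h.comap_glue (t := t) k, htt, h.comap_glue]

theorem glue_mono {t t' : Fin 3 → SimpleGraph V} (htt : ∀ k, t k ≤ t' k) : glue i t ≤ glue i t' :=
  iSup_mono fun k => SimpleGraph.map_monotone _ (htt k)

theorem exists_eq_glue (h : IsGluing c i) {G : SimpleGraph V} {T : SimpleGraph W}
    (hT : T ≤ glue i fun _ => G) : ∃ t : Fin 3 → SimpleGraph V, (∀ k, t k ≤ G) ∧ T = glue i t := by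
  refine ⟨fun k => T.comap (i k), fun k u v huv => h.glue_adj_apply.1 (hT huv), ?_⟩
  ext x y
  rw [h.glue_adj]
  constructor
  · intro hxy
    obtain ⟨k, u, v, -, rfl, rfl⟩ := h.glue_adj.1 (hT hxy)
    exact ⟨k, u, v, hxy, rfl, rfl⟩
  · rintro ⟨k, u, v, huv, rfl, rfl⟩
    exact huv

theorem glue_le_iff (h : IsGluing c i) {G : SimpleGraph V} :
    (glue i t ≤ glue i fun _ => G) ↔ ∀ k, t k ≤ G :=
  ⟨fun ht _ _ _ huv => h.glue_adj_apply.1 (ht (h.glue_adj_apply.2 huv)), glue_mono⟩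

/-- An outer corner belongs to a single copy, so its degree is already its degree there. -/
theorem neighborSet_outer (h : IsGluing c i) (k : Fin 3) :
    (glue i t).neighborSet (outer c i k) = i k '' (t k).neighborSet (c k) := by
  ext y
  simp only [SimpleGraph.mem_neighborSet, Set.mem_image, outer]
  constructor
  · intro hy
    obtain ⟨l, u, v, huv, hu, rfl⟩ := h.glue_adj.1 hy
    by_cases hkl : l = k
    · subst hkl
      exact ⟨v, h.injective _ hu ▸ huv, rfl⟩
    · exact absurd (h.corner_injective (h.overlap hkl hu).2).symm hkl
  · rintro ⟨v, hv, rfl⟩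
    exact h.glue_adj_apply.2 hv

theorem ncard_neighborSet_outer (h : IsGluing c i) (k : Fin 3) :
    ((glue i t).neighborSet (outer c i k)).ncard = ((t k).neighborSet (c k)).ncard := by
  rw [h.neighborSet_outer, Set.ncard_image_of_injective _ (h.injective k)]

theorem reachable (h : IsGluing c i) {k : Fin 3} {u v : V} (huv : (t k).Reachable u v) :
    (glue i t).Reachable (i k u) (i k v) :=
  huv.map (⟨i k, h.glue_adj_apply.2⟩ : t k →g glue i t)

/-- A vertex connected to a corner of a copy is connected, inside of each copy that contains it, to
a corner in the same cluster. -/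
theorem exists_of_reachable (h : IsGluing c i) {p : Fin 3 → Pattern}
    (hp : ∀ k l l', (t k).Reachable (c l) (c l') ↔ (p k).rel l l' = true) {k₀ l₀ : Fin 3} {w : W}
    (hw : (glue i t).Reachable (i k₀ (c l₀)) w) : ∀ k u, i k u = w →
      ∃ l, (cluster (p 0) (p 1) (p 2) (point k₀ l₀)).testBit (point k l) = true ∧
        (t k).Reachable (c l) u := by
  -- The conclusion does not depend on the copy in which a vertex is represented: a vertex of two
  -- copies is a corner of both, with the same `point` number.
  have transfer {k k' : Fin 3} {l : Fin 3} {v u : V} (hvu : i k' u = i k v)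
      (hb : (cluster (p 0) (p 1) (p 2) (point k₀ l₀)).testBit (point k l) = true)
      (hr : (t k).Reachable (c l) v) :
      ∃ l', (cluster (p 0) (p 1) (p 2) (point k₀ l₀)).testBit (point k' l') = true ∧
        (t k').Reachable (c l') u := by
    by_cases hkk : k' = k
    · subst hkk
      exact ⟨l, hb, h.injective _ hvu ▸ hr⟩
    · obtain ⟨rfl, rfl⟩ := h.overlap hkk hvu
      refine ⟨k, ?_, .refl _⟩
      rw [point_comm k' k]
      exact testBit_cluster_of_rel p (point_lt _ _) hb ((hp _ _ _).1 hr)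
  rw [SimpleGraph.reachable_iff_reflTransGen] at hw
  induction hw with
  | refl => exact fun k u hu => transfer hu (testBit_cluster_self _ _ _ _) (.refl _)
  | tail _ hadj ih =>
    intro k u hu
    obtain ⟨k', v, v', hv, rfl, rfl⟩ := h.glue_adj.1 hadj
    obtain ⟨l, hb, hr⟩ := ih k' v rfl
    exact transfer hu hb (hr.trans hv.reachable)

theorem reachable_iff_testBit (h : IsGluing c i) {p : Fin 3 → Pattern}
    (hp : ∀ k l l', (t k).Reachable (c l) (c l') ↔ (p k).rel l l' = true) (k₀ l₀ k l : Fin 3) :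
    (glue i t).Reachable (i k₀ (c l₀)) (i k (c l)) ↔
      (cluster (p 0) (p 1) (p 2) (point k₀ l₀)).testBit (point k l) = true := by
  constructor
  · intro hr
    obtain ⟨l', hb, hl'⟩ := h.exists_of_reachable hp hr k (c l) rfl
    exact testBit_cluster_of_rel p (point_lt _ _) hb ((hp _ _ _).1 hl')
  · intro hb
    -- A point number stands for `(k, l)` and `(l, k)`, which name the same vertex.
    have key : ∀ k l, (∃ k' l', point k' l' = point k l ∧
        (glue i t).Reachable (i k₀ (c l₀)) (i k' (c l'))) →
        (glue i t).Reachable (i k₀ (c l₀)) (i k (c l)) := by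
      rintro k l ⟨k', l', hkl, hr⟩
      obtain ⟨rfl, rfl⟩ | ⟨rfl, rfl⟩ := (point_eq_iff _ _ _ _).1 hkl
      · exact hr
      · rwa [h.comm l' k']
    refine key k l (cluster_induction p (R := fun y => ∃ k' l', point k' l' = y ∧
      (glue i t).Reachable (i k₀ (c l₀)) (i k' (c l'))) ⟨k₀, l₀, rfl, .refl _⟩ ?_ _ hb)
    intro k l l' hl hr
    exact ⟨k, l', rfl, (key k l hr).trans (h.reachable ((hp _ _ _).2 hl))⟩

theorem ncard_edgeSet_glue [Finite V] (h : IsGluing c i) :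
    (glue i t).edgeSet.ncard = ∑ k, (t k).edgeSet.ncard := by
  let f : (Σ k, (t k).edgeSet) → (glue i t).edgeSet := fun e =>
    ⟨Sym2.map (i e.1) e.2, by
      obtain ⟨k, e, he⟩ := e
      induction e with | _ u v
      exact h.glue_adj_apply.2 he⟩
  have hf : Function.Bijective f := by
    constructor
    · rintro ⟨k, e, he⟩ ⟨l, e', he'⟩ hee
      have hee : Sym2.map (i k) e = Sym2.map (i l) e' := congrArg Subtype.val hee
      obtain rfl : k = l := by
        induction e with | _ u v
        induction e' with | _ u' v'
        rw [SimpleGraph.mem_edgeSet] at he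
        rw [Sym2.map_mk, Sym2.map_mk, Sym2.eq_iff] at hee
        obtain ⟨h1, h2⟩ | ⟨h1, h2⟩ := hee
        · exact h.eq_of_eq_of_eq he.ne h1 h2
        · exact h.eq_of_eq_of_eq he.ne h1 h2
      obtain rfl := Sym2.map.injective (h.injective k) hee
      rfl
    · rintro ⟨e, he⟩
      induction e with | _ x y
      obtain ⟨k, u, v, huv, rfl, rfl⟩ := h.glue_adj.1 he
      exact ⟨⟨k, s(u, v), huv⟩, rfl⟩
  rw [← Nat.card_coe_set_eq, ← Nat.card_congr (Equiv.ofBijective f hf), Nat.card_sigma]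
  simp

theorem card_add_three [Finite V] (h : IsGluing c i) : Nat.card W + 3 = 3 * Nat.card V := by
  have hr (k) : (Set.range (i k)).ncard = Nat.card V := by
    rw [← Set.image_univ, Set.ncard_image_of_injective _ (h.injective k), Set.ncard_univ]
  have hi {k l : Fin 3} (hkl : k ≠ l) : Set.range (i k) ∩ Set.range (i l) = {i k (c l)} := by
    ext w
    constructor
    · rintro ⟨⟨u, rfl⟩, v, hv⟩
      rw [(h.overlap hkl hv.symm).1]
      rfl
    · rintro rfl
      exact ⟨⟨_, rfl⟩, _, (h.comm k l).symm⟩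
  have h1 := Set.ncard_union_add_ncard_inter (Set.range (i 0)) (Set.range (i 1))
    (Set.finite_range _) (Set.finite_range _)
  have h2 := Set.ncard_union_add_ncard_inter (Set.range (i 0) ∪ Set.range (i 1)) (Set.range (i 2))
    ((Set.finite_range _).union (Set.finite_range _)) (Set.finite_range _)
  have hne : i 0 (c 2) ≠ i 1 (c 2) := by
    intro he
    have := h.corner_injective (h.overlap (by decide) he).1
    exact absurd this (by decide)
  have hu : Set.range (i 0) ∪ Set.range (i 1) ∪ Set.range (i 2) = Set.univ := by
    refine Set.eq_univ_of_forall fun w => ?_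
    obtain ⟨k, u, rfl⟩ := h.cover w
    fin_cases k
    · exact Or.inl (Or.inl ⟨u, rfl⟩)
    · exact Or.inl (Or.inr ⟨u, rfl⟩)
    · exact Or.inr ⟨u, rfl⟩
  rw [hi (by decide), Set.ncard_singleton, hr, hr] at h1
  rw [hu, Set.union_inter_distrib_right, hi (by decide), hi (by decide), Set.singleton_union,
    Set.ncard_pair hne, Set.ncard_univ, hr] at h2
  omega

/-- Spanning forests of the glued graph are glued from spanning forests of the copies. -/
theorem isForest_glue_iff [Finite V] (h : IsGluing c i) {q : Pattern} :
    IsForest (glue i t) (outer c i) q ↔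
      ∃ p : Fin 3 → Pattern, Glues (p 0) (p 1) (p 2) q ∧ ∀ k, IsForest (t k) c (p k) := by
  have hW := h.card_add_three
  have hE := h.ncard_edgeSet_glue (t := t)
  rw [Fin.sum_univ_three] at hE
  constructor
  · rintro ⟨hcover, hrel, hcard⟩
    choose p hp using fun k => exists_pattern (t k) c
    have hreach := h.reachable_iff_testBit hp
    have hcov (k : Fin 3) (u : V) : ∃ l, (t k).Reachable (c l) u := by
      obtain ⟨k', hk'⟩ := hcover (i k u)
      obtain ⟨l, -, hl⟩ := h.exists_of_reachable hp hk' k u rfl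
      exact ⟨l, hl⟩
    have hjoins : Joins (p 0) (p 1) (p 2) q := by
      constructor
      · intro y
        obtain ⟨k, l, hy⟩ : ∃ k l, point k l = y := by
          revert y
          decide
        obtain ⟨m, hm⟩ := hcover (i k (c l))
        refine ⟨m, ?_⟩
        rw [← hy, ← point_self m]
        exact (hreach _ _ _ _).1 hm
      · intro k l
        rw [Bool.eq_iff_iff, ← hrel, ← point_self k, ← point_self l]
        exact (hreach _ _ _ _).symm
    have hle (k) := card_le_ncard_edgeSet_add_size (hcov k) (hp k)
    have hsize := hjoins.size_le
    have h0 := hle 0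
    have h1 := hle 1
    have h2 := hle 2
    -- Summing `hle` and using `hsize` gives `3 * Nat.card V` ≤ edges + sizes ≤ edges + 3 +
    -- `q.size`. The last sum is `3 * Nat.card V` by `hcard` and `hW`, so all the inequalities are
    -- equalities.
    refine ⟨p, ⟨by omega, hjoins⟩, fun k => ⟨hcov k, hp k, ?_⟩⟩
    fin_cases k <;> simp only [Fin.zero_eta, Fin.mk_one, Fin.reduceFinMk] <;> omega
  · rintro ⟨p, ⟨hsize, hjoins⟩, hp⟩
    have hreach := h.reachable_iff_testBit fun k => (hp k).rel
    refine ⟨fun w => ?_, fun k l => ?_, ?_⟩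
    · obtain ⟨k, u, rfl⟩ := h.cover w
      obtain ⟨l, hl⟩ := (hp k).cover u
      obtain ⟨m, hm⟩ := hjoins.1 ⟨point k l, point_lt k l⟩
      rw [← point_self m] at hm
      exact ⟨m, ((hreach m m k l).2 hm).trans (h.reachable hl)⟩
    · rw [← hjoins.2 k l, ← point_self k, ← point_self l]
      exact hreach k k l l
    · have h0 := (hp 0).card
      have h1 := (hp 1).card
      have h2 := (hp 2).card
      omega

end IsGluing

/-! ### Counting forests of a glued graph -/

/-- The number of spanning forests of `G` with corner pattern `p` and the property `P`. -/
noncomputable def numForests (G : SimpleGraph V) (c : Fin 3 → V) (P : SimpleGraph V → Prop)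
    (p : Pattern) : ℕ :=
  Nat.card {T : SimpleGraph V // T ≤ G ∧ IsForest T c p ∧ P T}

/-- A glued forest determines its three restrictions and each restriction determines its pattern, so
the sum over gluings counts every forest once. -/
theorem IsGluing.numForests_glue [Finite V] {c : Fin 3 → V} {i : Fin 3 → V → W} (h : IsGluing c i)
    (G : SimpleGraph V) {P : SimpleGraph V → Prop} {Q : SimpleGraph W → Prop}
    (hPQ : ∀ t, Q (glue i t) ↔ P (t 0)) (q : Pattern) :
    numForests (glue i fun _ => G) (outer c i) Q q =
      ∑ x ∈ gluings q, numForests G c P x.1 * numForests G c (fun _ => True) x.2.1 *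
        numForests G c (fun _ => True) x.2.2 := by
  let A (P : SimpleGraph V → Prop) (p : Pattern) := {T // T ≤ G ∧ IsForest T c p ∧ P T}
  let f : (Σ x : gluings q, (A P x.1.1 × A (fun _ => True) x.1.2.1) × A (fun _ => True) x.1.2.2) →
      {T // T ≤ glue i (fun _ => G) ∧ IsForest T (outer c i) q ∧ Q T} := fun y =>
    ⟨glue i ![y.2.1.1.1, y.2.1.2.1, y.2.2.1], by
      obtain ⟨⟨⟨p₀, p₁, p₂⟩, hx⟩, ⟨⟨t₀, h₀⟩, t₁, h₁⟩, t₂, h₂⟩ := y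
      refine ⟨h.glue_le_iff.2 ?_, h.isForest_glue_iff.2 ⟨![p₀, p₁, p₂], ?_, ?_⟩, (hPQ _).2 h₀.2.2⟩
      · exact Fin.forall_fin_succ.2 ⟨h₀.1, Fin.forall_fin_succ.2 ⟨h₁.1, by simpa using h₂.1⟩⟩
      · exact (Finset.mem_filter.1 hx).2
      · exact Fin.forall_fin_succ.2 ⟨h₀.2.1, Fin.forall_fin_succ.2 ⟨h₁.2.1, by simpa using h₂.2.1⟩⟩⟩
  have hf : Function.Bijective f := by
    constructor
    · rintro ⟨⟨⟨p₀, p₁, p₂⟩, hx⟩, ⟨⟨t₀, h₀⟩, t₁, h₁⟩, t₂, h₂⟩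
        ⟨⟨⟨p₀', p₁', p₂'⟩, hx'⟩, ⟨⟨t₀', h₀'⟩, t₁', h₁'⟩, t₂', h₂'⟩ hyy
      have ht : ![t₀, t₁, t₂] = ![t₀', t₁', t₂'] := h.glue_injective (congrArg Subtype.val hyy)
      obtain rfl : t₀ = t₀' := congrFun ht 0
      obtain rfl : t₁ = t₁' := congrFun ht 1
      obtain rfl : t₂ = t₂' := congrFun ht 2
      obtain rfl := pattern_unique h₀.2.1.rel h₀'.2.1.rel
      obtain rfl := pattern_unique h₁.2.1.rel h₁'.2.1.rel
      obtain rfl := pattern_unique h₂.2.1.rel h₂'.2.1.rel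
      rfl
    · rintro ⟨T, hT, hforest, hQ⟩
      obtain ⟨t, ht, rfl⟩ := h.exists_eq_glue hT
      obtain ⟨p, hp, hpt⟩ := h.isForest_glue_iff.1 hforest
      refine ⟨⟨⟨(p 0, p 1, p 2), Finset.mem_filter.2 ⟨Finset.mem_univ _, hp⟩⟩,
        (⟨t 0, ht 0, hpt 0, (hPQ t).1 hQ⟩, ⟨t 1, ht 1, hpt 1, trivial⟩),
        ⟨t 2, ht 2, hpt 2, trivial⟩⟩, Subtype.ext ?_⟩
      refine congrArg (glue i) ?_
      funext k
      fin_cases k <;> rfl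
  rw [numForests, ← Nat.card_congr (Equiv.ofBijective f hf), Nat.card_sigma]
  simp only [Nat.card_prod]
  exact Finset.sum_coe_sort (gluings q) fun x =>
    numForests G c P x.1 * numForests G c (fun _ => True) x.2.1 *
      numForests G c (fun _ => True) x.2.2

/-! ### The gasket as a gluing -/

/-- The three corners `o`, `a_n` and `b_n` of `SG(n)`. -/
def corner (n : ℕ) : Fin 3 → Vert n := ![o n, a n, b n]

/-- The translations by which the three copies of `SG(n)` are placed in `SG(n + 1)`. -/
def shift (n : ℕ) : Fin 3 → ℕ × ℕ → ℕ × ℕ :=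
  ![fun p => p, fun p => (p.1 + 2 ^ n, p.2), fun p => (p.1, p.2 + 2 ^ n)]

theorem mem_verts_succ {n : ℕ} {w : ℕ × ℕ} :
    w ∈ verts (n + 1) ↔ ∃ k, ∃ p ∈ verts n, shift n k p = w := by
  simp [verts, shift, Fin.exists_fin_succ, -Prod.exists]

/-- The inclusions of the three copies of `SG(n)` into `SG(n + 1)`. -/
def copy (n : ℕ) (k : Fin 3) (v : Vert n) : Vert (n + 1) :=
  ⟨shift n k v.1, mem_verts_succ.2 ⟨k, v.1, v.2, rfl⟩⟩

/-- This bound forces translated copies to meet only at corners. -/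
theorem add_le_of_mem_verts {n : ℕ} : ∀ {p : ℕ × ℕ}, p ∈ verts n → p.1 + p.2 ≤ 2 ^ n := by
  induction n with
  | zero => simp [verts]
  | succ n ih =>
    intro w hw
    obtain ⟨k, p, hp, rfl⟩ := mem_verts_succ.1 hw
    have := ih hp
    fin_cases k <;> simp [shift, pow_succ] <;> omega

theorem shift_injective (n : ℕ) (k : Fin 3) : Function.Injective (shift n k) := by
  rintro ⟨x, y⟩ ⟨x', y'⟩ h
  fin_cases k <;> simpa [shift] using h

theorem isGluing_copy (n : ℕ) : IsGluing (corner n) (copy n) where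
  corner_injective := by
    have : 2 ^ n ≠ 0 := by positivity
    intro k l h
    replace h := congrArg Subtype.val h
    fin_cases k <;> fin_cases l <;> first | rfl | (simp [corner, o, a, b] at h <;> omega)
  injective k u v h := Subtype.ext (shift_injective n k (congrArg Subtype.val h))
  comm k l := by
    apply Subtype.ext
    fin_cases k <;> fin_cases l <;> simp [corner, copy, shift, o, a, b]
  overlap := by
    rintro k l ⟨⟨x, y⟩, hu⟩ ⟨⟨x', y'⟩, hv⟩ hkl h
    replace h := congrArg Subtype.val h
    have hu := add_le_of_mem_verts hu
    have hv := add_le_of_mem_verts hv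
    fin_cases k <;> fin_cases l <;>
      simp [corner, copy, shift, o, a, b] at h hkl hu hv ⊢ <;> omega
  cover := by
    rintro ⟨w, hw⟩
    obtain ⟨k, p, hp, rfl⟩ := mem_verts_succ.1 hw
    exact ⟨k, ⟨p, hp⟩, rfl⟩

theorem outer_copy (n : ℕ) : outer (corner n) (copy n) = corner (n + 1) := by
  funext k
  apply Subtype.ext
  fin_cases k <;> simp [outer, corner, copy, shift, o, a, b, pow_succ, mul_two]

theorem latticeGraph_succ_adj {n : ℕ} {x y : ℕ × ℕ} : (latticeGraph (n + 1)).Adj x y ↔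
    ∃ k u v, (latticeGraph n).Adj u v ∧ shift n k u = x ∧ shift n k v = y := by
  have h (k : Fin 3) : ((latticeGraph n).map (shift n k)).Adj x y ↔
      ∃ u v, (latticeGraph n).Adj u v ∧ shift n k u = x ∧ shift n k v = y :=
    SimpleGraph.map_adj ⟨shift n k, shift_injective n k⟩ _ _ _
  have h0 : ((latticeGraph n).map (shift n 0)) = latticeGraph n := SimpleGraph.map_id _
  rw [Fin.exists_fin_succ, Fin.exists_fin_two, ← h 0, h0]
  exact or_assoc.trans (or_congr Iff.rfl (or_congr (h 1) (h 2)))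

theorem mem_verts_of_adj {n : ℕ} : ∀ {x y : ℕ × ℕ}, (latticeGraph n).Adj x y → x ∈ verts n := by
  induction n with
  | zero =>
    intro x y h
    simp only [latticeGraph, SimpleGraph.fromRel_adj] at h
    tauto
  | succ n ih =>
    intro x y h
    obtain ⟨k, u, v, huv, rfl, -⟩ := latticeGraph_succ_adj.1 h
    exact mem_verts_succ.2 ⟨k, u, ih huv, rfl⟩

theorem SG_succ (n : ℕ) : SG (n + 1) = glue (copy n) fun _ => SG n := by
  ext x y
  rw [(isGluing_copy n).glue_adj, SG, SimpleGraph.comap_adj, latticeGraph_succ_adj]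
  constructor
  · rintro ⟨k, u, v, huv, hu, hv⟩
    exact ⟨k, ⟨u, mem_verts_of_adj huv⟩, ⟨v, mem_verts_of_adj huv.symm⟩, huv, Subtype.ext hu,
      Subtype.ext hv⟩
  · rintro ⟨k, u, v, huv, rfl, rfl⟩
    exact ⟨k, u, v, huv, rfl, rfl⟩

/-- The number of spanning forests of `SG(n)` with corner pattern `p`. -/
noncomputable def count (n : ℕ) (p : Pattern) : ℕ :=
  numForests (SG n) (corner n) (fun _ => True) p

/-- The number of spanning forests of `SG(n)` with corner pattern `p` and `j` bonds at `o`. -/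
noncomputable def countAt (j n : ℕ) (p : Pattern) : ℕ :=
  numForests (SG n) (corner n) (fun T => bonds T (o n) = j) p

theorem count_succ (n : ℕ) (q : Pattern) :
    count (n + 1) q = ∑ x ∈ gluings q, count n x.1 * count n x.2.1 * count n x.2.2 := by
  rw [count, SG_succ, ← outer_copy]
  exact (isGluing_copy n).numForests_glue _ (fun _ => Iff.rfl) q

theorem countAt_succ (j n : ℕ) (q : Pattern) :
    countAt j (n + 1) q = ∑ x ∈ gluings q, countAt j n x.1 * count n x.2.1 * count n x.2.2 := by
  rw [countAt, SG_succ, ← outer_copy]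
  refine (isGluing_copy n).numForests_glue _ (fun t => ?_) q
  have h : outer (corner n) (copy n) 0 = o (n + 1) := congrFun (outer_copy n) 0
  rw [bonds, ← h, (isGluing_copy n).ncard_neighborSet_outer]
  rfl

theorem numF_eq (n : ℕ) : numF n = count n .full := by
  rw [numF, ← Nat.card_coe_set_eq]
  simp only [spanningTrees, isTree_iff_isForest (c := corner n), count, numForests, and_true]
  rfl

theorem numFAt_eq (j n : ℕ) : numFAt j n (o n) = countAt j n .full := by
  rw [numFAt, ← Nat.card_coe_set_eq]
  simp only [spanningTrees, isTree_iff_isForest (c := corner n), countAt, numForests,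
    Set.mem_ofPred_eq, and_assoc]
  rfl

theorem numG_eq (n : ℕ) : numG n = count n (.sep 2) := by
  rw [numG, ← Nat.card_coe_set_eq]
  simp only [← twoTrees_iff_isForest (c := corner n), count, numForests, and_true]
  rfl

theorem numGAt_eq (j n : ℕ) : numGAt j n (o n) = countAt j n (.sep 2) := by
  rw [numGAt, ← Nat.card_coe_set_eq]
  simp only [← twoTrees_iff_isForest (c := corner n), countAt, numForests, twoTrees,
    Set.mem_ofPred_eq, and_assoc]
  rfl

/-! ### The triangle `SG(0)` -/

/-- The subgraph of the triangle `SG(0)` with prescribed edges `o a`, `o b` and `a b`. -/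
def triangle (x : Bool × Bool × Bool) : SimpleGraph (Vert 0) :=
  SimpleGraph.fromRel fun u v => (u = o 0 ∧ v = a 0 ∧ x.1 = true) ∨
    (u = o 0 ∧ v = b 0 ∧ x.2.1 = true) ∨ (u = a 0 ∧ v = b 0 ∧ x.2.2 = true)

instance (x : Bool × Bool × Bool) : DecidableRel (triangle x).Adj := fun u v =>
  decidable_of_iff _ (SimpleGraph.fromRel_adj _ u v).symm

theorem forall_vert_zero {P : Vert 0 → Prop} : (∀ v, P v) ↔ ∀ k, P (corner 0 k) := by
  refine ⟨fun h k => h _, fun h v => ?_⟩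
  obtain ⟨k, rfl⟩ : ∃ k, corner 0 k = v := by
    revert v
    decide
  exact h k

theorem SG_zero : SG 0 = ⊤ := by
  ext u v
  simp only [SG, latticeGraph, SimpleGraph.comap_adj, SimpleGraph.fromRel_adj, SimpleGraph.top_adj]
  exact ⟨fun h e => h.1 (congrArg _ e), fun h => ⟨fun e => h (Subtype.ext e), Or.inl ⟨u.2, v.2⟩⟩⟩

theorem triangle_adj (x : Bool × Bool × Bool) : ((triangle x).Adj (o 0) (a 0) ↔ x.1 = true) ∧
    ((triangle x).Adj (o 0) (b 0) ↔ x.2.1 = true) ∧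
    ((triangle x).Adj (a 0) (b 0) ↔ x.2.2 = true) := by
  revert x
  decide

theorem ext_of_adj_corner {T T' : SimpleGraph (Vert 0)}
    (h1 : T.Adj (o 0) (a 0) ↔ T'.Adj (o 0) (a 0)) (h2 : T.Adj (o 0) (b 0) ↔ T'.Adj (o 0) (b 0))
    (h3 : T.Adj (a 0) (b 0) ↔ T'.Adj (a 0) (b 0)) : T = T' := by
  ext u v
  revert u v
  rw [forall_vert_zero]
  intro k
  rw [forall_vert_zero]
  intro l
  fin_cases k <;> fin_cases l <;>
    simp [corner, h1, h2, h3, T.adj_comm (b 0), T'.adj_comm (b 0), T.adj_comm (a 0) (o 0),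
      T'.adj_comm (a 0) (o 0)]

theorem triangle_bijective : Function.Bijective triangle := by
  classical
  constructor
  · intro x y hxy
    obtain ⟨h1, h2, h3⟩ := triangle_adj x
    obtain ⟨h1', h2', h3'⟩ := triangle_adj y
    rw [hxy] at h1 h2 h3
    exact Prod.ext (Bool.eq_iff_iff.2 (h1.symm.trans h1'))
      (Prod.ext (Bool.eq_iff_iff.2 (h2.symm.trans h2')) (Bool.eq_iff_iff.2 (h3.symm.trans h3')))
  · intro T
    refine ⟨(decide (T.Adj (o 0) (a 0)), decide (T.Adj (o 0) (b 0)),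
      decide (T.Adj (a 0) (b 0))), ?_⟩
    apply ext_of_adj_corner <;> simp [triangle_adj]

/-- Every vertex of `SG(0)` is a corner, so `cover` is automatic and a decidable condition on eight
subgraphs remains. -/
theorem numForests_zero (p : Pattern) {P : SimpleGraph (Vert 0) → Prop}
    (D : Bool × Bool × Bool → Prop) [DecidablePred D] (hD : ∀ x, D x ↔ P (triangle x)) :
    numForests (SG 0) (corner 0) P p = Fintype.card {x // (∀ k l,
      (triangle x).Reachable (corner 0 k) (corner 0 l) ↔ p.rel k l = true) ∧
      (triangle x).edgeFinset.card + p.size = 3 ∧ D x} := by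
  rw [numForests, ← Nat.card_eq_fintype_card]
  refine (Nat.card_congr ((Equiv.ofBijective _ triangle_bijective).subtypeEquiv fun x => ?_)).symm
  have hcard : Nat.card (Vert 0) = 3 := by
    rw [Nat.card_eq_fintype_card]
    decide
  rw [Equiv.ofBijective_apply, SG_zero, and_assoc.symm]
  refine and_congr ?_ (hD x) |>.trans (and_iff_right le_top).symm
  have he : (triangle x).edgeSet.ncard = (triangle x).edgeFinset.card := by
    rw [← SimpleGraph.coe_edgeFinset, Set.ncard_coe_finset]
  refine ⟨fun h => ⟨forall_vert_zero.2 fun k => ⟨k, .refl _⟩, h.1, by rw [he, hcard]; exact h.2⟩,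
    fun h => ⟨h.rel, ?_⟩⟩
  rw [← he, ← hcard]
  exact h.card

theorem count_zero : count 0 .full = 3 ∧ (∀ k, count 0 (.sep k) = 1) ∧ count 0 .discrete = 1 := by
  simp only [count, numForests_zero (P := fun _ => True) _ (fun _ => True) fun _ => Iff.rfl]
  decide +kernel

theorem countAt_zero (j : ℕ) (p : Pattern) : countAt j 0 p = Fintype.card {x // (∀ k l,
      (triangle x).Reachable (corner 0 k) (corner 0 l) ↔ p.rel k l = true) ∧
      (triangle x).edgeFinset.card + p.size = 3 ∧ (triangle x).degree (o 0) = j} := by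
  refine numForests_zero p _ fun x => ?_
  rw [bonds, Set.ncard_eq_toFinset_card']
  rfl

theorem countAt_one_zero : countAt 1 0 .full = 2 ∧ countAt 1 0 (.sep 1) = 1 ∧
    countAt 1 0 (.sep 2) = 1 := by
  simp only [countAt_zero]
  decide +kernel

theorem countAt_two_zero : countAt 2 0 .full = 1 ∧ countAt 2 0 (.sep 1) = 0 ∧
    countAt 2 0 (.sep 2) = 0 := by
  simp only [countAt_zero]
  decide +kernel

/-! ### Recursions and their solution -/

open Pattern

/-- In this list and those for `sep 1` and `sep 2`, the first entry is always `full`, `sep 1` or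
`sep 2`. The recursion for `countAt` therefore closes on these three patterns. -/
theorem gluings_full :
    gluings full = {
    (full, full, sep 0), (full, full, sep 1), (full, sep 0, full), (full, sep 2, full),
    (sep 1, full, full), (sep 2, full, full)} := by
  decide +kernel

theorem gluings_sep_one :
    gluings (sep 1) = {
    (full, sep 0, sep 1), (full, sep 1, sep 0), (full, sep 1, sep 1), (full, discrete, full),
    (sep 1, full, sep 1), (sep 1, sep 1, full), (sep 1, sep 2, full), (sep 2, sep 1, full)} := by
  decide +kernel

theorem gluings_sep_two :
    gluings (sep 2) = {
    (full, full, discrete), (full, sep 0, sep 2), (full, sep 2, sep 0), (full, sep 2, sep 2),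
    (sep 1, full, sep 2), (sep 2, full, sep 1), (sep 2, full, sep 2), (sep 2, sep 2, full)} := by
  decide +kernel

theorem gluings_sep_zero :
    gluings (sep 0) = {
    (full, sep 0, sep 0), (sep 0, full, sep 0), (sep 0, full, sep 1), (sep 0, sep 0, full),
    (sep 0, sep 2, full), (sep 1, full, sep 0), (sep 2, sep 0, full), (discrete, full, full)} := by
  decide +kernel

/-- The numbers of spanning forests of `SG(n)` depend only on the number of trees. -/
structure HasCounts (n f g h : ℕ) : Prop where
  full : count n full = f
  sep : ∀ k, count n (sep k) = g
  discrete : count n discrete = h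

/-- The number of classes, for each of three patterns. -/
def sizes (x : Pattern × Pattern × Pattern) : ℕ × ℕ × ℕ := (x.1.size, x.2.1.size, x.2.2.size)

/-- Sizes are enough here, because this list is needed only for `count`, which depends on the size
alone. -/
theorem sizes_gluings_discrete : (gluings discrete).val.map sizes =
    14 • {(2, 2, 2)} +
      2 • {(1, 2, 3), (1, 3, 2), (2, 1, 3), (2, 3, 1), (3, 1, 2), (3, 2, 1)} := by
  decide +kernel

theorem HasCounts.succ {n f g h : ℕ} (H : HasCounts n f g h) :
    HasCounts (n + 1) (6 * f ^ 2 * g) (7 * f * g ^ 2 + f ^ 2 * h) (14 * g ^ 3 + 12 * f * g * h) where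
  full := by
    simp [count_succ, gluings_full, H.full, H.sep]
    ring
  sep k := by
    fin_cases k
    · simp [count_succ, gluings_sep_zero, H.full, H.sep, H.discrete]
      ring
    · simp [count_succ, gluings_sep_one, H.full, H.sep, H.discrete]
      ring
    · simp [count_succ, gluings_sep_two, H.full, H.sep, H.discrete]
      ring
  discrete := by
    let v : ℕ → ℕ := fun s => if s = 1 then f else if s = 2 then g else h
    have hv (p : Pattern) : count n p = v p.size := by
      cases p <;> simp [v, size, H.full, H.sep, H.discrete]
    have key : count (n + 1) .discrete =
        (((gluings .discrete).val.map sizes).map fun s => v s.1 * v s.2.1 * v s.2.2).sum := by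
      simp only [count_succ, hv, Multiset.map_map]
      rfl
    rw [key, sizes_gluings_discrete]
    simp [v, Multiset.map_nsmul, Multiset.sum_nsmul]
    ring

/-- Of the six gluings, four have `full` in the copy that contains `o`; the other two have `sep 1`
or `sep 2` there, which contribute the same `y`. -/
theorem HasCounts.countAt_full_succ {n f g h : ℕ} (H : HasCounts n f g h) {j y : ℕ}
    (h1 : countAt j n (.sep 1) = y) (h2 : countAt j n (.sep 2) = y) :
    countAt j (n + 1) .full = 4 * countAt j n .full * f * g + 2 * y * f ^ 2 := by
  simp [countAt_succ, gluings_full, H.full, H.sep, h1, h2]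
  ring

theorem HasCounts.countAt_sep_one_succ {n f g h : ℕ} (H : HasCounts n f g h) {j y : ℕ}
    (h1 : countAt j n (.sep 1) = y) (h2 : countAt j n (.sep 2) = y) :
    countAt j (n + 1) (.sep 1) = countAt j n .full * (3 * g ^ 2 + f * h) + 4 * y * f * g := by
  simp [countAt_succ, gluings_sep_one, H.full, H.sep, H.discrete, h1, h2]
  ring

theorem HasCounts.countAt_sep_two_succ {n f g h : ℕ} (H : HasCounts n f g h) {j y : ℕ}
    (h1 : countAt j n (.sep 1) = y) (h2 : countAt j n (.sep 2) = y) :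
    countAt j (n + 1) (.sep 2) = countAt j n .full * (3 * g ^ 2 + f * h) + 4 * y * f * g := by
  simp [countAt_succ, gluings_sep_two, H.full, H.sep, H.discrete, h1, h2]
  ring

/-- The invariant reduces the recursion to `6 f² g`, `10 f g²`, `50 g³`, and `6 · 50 = 3 · 10²`
reproduces it. -/
theorem exists_hasCounts (n : ℕ) :
    ∃ f g h, HasCounts n f g h ∧ f * h = 3 * g ^ 2 ∧ 0 < f ∧ 0 < g := by
  induction n with
  | zero => exact ⟨3, 1, 1, ⟨count_zero.1, count_zero.2.1, count_zero.2.2⟩, by norm_num⟩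
  | succ n ih =>
    obtain ⟨f, g, h, H, hfgh, hf, hg⟩ := ih
    refine ⟨_, _, _, H.succ, ?_, by positivity, by positivity⟩
    have e1 : 7 * f * g ^ 2 + f ^ 2 * h = 10 * f * g ^ 2 := by
      linear_combination f * hfgh
    have e2 : 14 * g ^ 3 + 12 * f * g * h = 50 * g ^ 3 := by
      linear_combination 12 * g * hfgh
    rw [e1, e2]
    ring

/-- The proportions of the spanning trees, and of the two-tree forests, of `SG(n)` with `j` bonds at
`o` approach each other by a factor of `1 / 15` with every stage. -/
theorem countAt_eq {j : ℕ} {A B : ℝ} (h0 : (countAt j 0 .full : ℝ) = (A + 5 * B) * 3)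
    (h1 : (countAt j 0 (.sep 1) : ℝ) = A - 9 * B) (h2 : (countAt j 0 (.sep 2) : ℝ) = A - 9 * B)
    (n : ℕ) :
    (countAt j n .full : ℝ) = (A + 5 * B * (1 / 15) ^ n) * count n .full ∧
    (countAt j n (.sep 1) : ℝ) = (A - 9 * B * (1 / 15) ^ n) * count n (.sep 1) ∧
    (countAt j n (.sep 2) : ℝ) = (A - 9 * B * (1 / 15) ^ n) * count n (.sep 2) := by
  induction n with
  | zero => simp [h0, h1, h2, count_zero]
  | succ n ih =>
    obtain ⟨f, g, h, H, hfgh, hf, hg⟩ := exists_hasCounts n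
    rw [H.full, H.sep, H.sep] at ih
    obtain ⟨i0, i1, i2⟩ := ih
    have hy : countAt j n (.sep 1) = countAt j n (.sep 2) := by
      exact_mod_cast i1.trans i2.symm
    have hR : (f * h : ℝ) = 3 * g ^ 2 := by exact_mod_cast hfgh
    rw [H.countAt_full_succ hy rfl, H.countAt_sep_one_succ hy rfl, H.countAt_sep_two_succ hy rfl,
      H.succ.full, H.succ.sep, H.succ.sep]
    push_cast
    rw [i0, i2, pow_succ]
    refine ⟨?_, ?_, ?_⟩
    · ring
    -- The product `f * h` is replaced by `3 * g ^ 2` on both sides; its coefficients there are `f`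
    -- times the old proportion for `full` and `f` times the new one for `sep`.
    all_goals
      linear_combination
        (A + 5 * B * (1 / 15 : ℝ) ^ n - (A - 9 * B * ((1 / 15 : ℝ) ^ n * (1 / 15)))) * f * hR

end SierpinskiGasket

theorem mainTheorem2 (n : ℕ) :
    SierpinskiGasket.F 1 n (SierpinskiGasket.o n) = 11 / 14 - 5 / 42 * (1 / 15 : ℝ) ^ n ∧
    SierpinskiGasket.F 2 n (SierpinskiGasket.o n) = 3 / 14 + 5 / 42 * (1 / 15 : ℝ) ^ n ∧
    SierpinskiGasket.G 1 n (SierpinskiGasket.o n) = 11 / 14 + 3 / 14 * (1 / 15 : ℝ) ^ n ∧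
    SierpinskiGasket.G 2 n (SierpinskiGasket.o n) = 3 / 14 - 3 / 14 * (1 / 15 : ℝ) ^ n := by
  have hpos : (0 : ℝ) < SierpinskiGasket.count n .full ∧
      (0 : ℝ) < SierpinskiGasket.count n (.sep 2) := by
    obtain ⟨f, g, h, H, -, hf, hg⟩ := SierpinskiGasket.exists_hasCounts n
    rw [H.full, H.sep]
    exact ⟨by exact_mod_cast hf, by exact_mod_cast hg⟩
  obtain ⟨a0, a1, a2⟩ := SierpinskiGasket.countAt_one_zero
  obtain ⟨b0, b1, b2⟩ := SierpinskiGasket.countAt_two_zero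
  -- On the triangle the proportions are `2 / 3` and `1` for degree one, and `1 / 3` and `0` for
  -- degree two; `A` and `B` solve `A + 5 B = F`, `A - 9 B = G` for these values.
  obtain ⟨hF1, -, hG1⟩ := SierpinskiGasket.countAt_eq (j := 1) (A := 11 / 14) (B := -1 / 42)
    (by rw [a0]; norm_num) (by rw [a1]; norm_num) (by rw [a2]; norm_num) n
  obtain ⟨hF2, -, hG2⟩ := SierpinskiGasket.countAt_eq (j := 2) (A := 3 / 14) (B := 1 / 42)
    (by rw [b0]; norm_num) (by rw [b1]; norm_num) (by rw [b2]; norm_num) n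
  simp only [SierpinskiGasket.F, SierpinskiGasket.G, SierpinskiGasket.numFAt_eq,
    SierpinskiGasket.numF_eq, SierpinskiGasket.numGAt_eq, SierpinskiGasket.numG_eq]
  rw [hF1, hF2, hG1, hG2, mul_div_cancel_right₀ _ hpos.1.ne', mul_div_cancel_right₀ _ hpos.1.ne',
    mul_div_cancel_right₀ _ hpos.2.ne', mul_div_cancel_right₀ _ hpos.2.ne']
  refine ⟨?_, ?_, ?_, ?_⟩ <;> ring
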